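/- Let $k$ be a quadratic number field with discriminant $d$. Suppose that there is an extension $M/k$ which is unramified at all finite primes, has $\operatorname{Gal}(M/k)\simeq H_8$ (the quaternion group of order $8$), and is normal over $\mathbb Q$. Then: 1. $\operatorname{Gal}(M/\mathbb Q)\simeq D_4 \curlyvee C_4$, the central product of order $16$ of the dihedral group $D_4$ of order $8$ and the cyclic group $C_4$ of order $4$, i.e. the quotient of $D_4\times C_4$ by the subgroup of order $2$ generated by the pair consisting of the central involution of $D_4$ and the involution of $C_4$. 2. There is a factorization $d=d_1d_2d_3$ in which each $d_i$ is the discriminant of a quadratic number field (in particular $d_i\neq 1$), and at most one of $d_1,d_2,d_3$ is negative. 3. For this factorization, $(d_1d_2/p_3)=(d_2d_3/p_1)=(d_3d_1/p_2)=+1$ for all primes $p_1\mid d_1$, $p_2\mid d_2$, $p_3\mid d_3$, where $(\cdot/p)$ is the Legendre symbol for odd $p$ and the Kronecker symbol for $p=2$. -/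

import Mathlib

open scoped NumberField

/-- `L/K` is unramified: no finite prime ramifies (infinite places are unrestricted). -/
def IsUnramifiedOutsideInfinity (K L : Type*) [Field K] [NumberField K] [Field L] [NumberField L]
    [Algebra K L] : Prop :=
  ∀ (P : Ideal (𝓞 L)) [P.IsPrime], P ≠ ⊥ → Algebra.IsUnramifiedAt (𝓞 K) P

/-- `D` is the discriminant of a quadratic number field. In particular `D ≠ 1`. -/
def IsQuadraticFieldDiscriminant (D : ℤ) : Prop :=
  ∃ (F : Type) (_ : Field F) (_ : NumberField F),
    Algebra.IsQuadraticExtension ℚ F ∧ NumberField.discr F = D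

/-- The Kronecker symbol `(a/p)` at a prime `p`: for odd `p` the Legendre symbol, and for `p = 2`
it is `0` for even `a`, `1` for `a ≡ ±1 mod 8` and `-1` for `a ≡ ±3 mod 8`. -/
def kroneckerAtPrime (a : ℤ) (p : ℕ) [Fact p.Prime] : ℤ :=
  if p = 2 then ZMod.χ₈ (a : ZMod 8) else legendreSym p a

/-- The subgroup of `D₄ × C₄` generated by the pair formed by the central involution of `D₄` (of
order `8`) and the involution of `C₄`. -/
def amalgamatedInvolution : Subgroup (DihedralGroup 4 × Multiplicative (ZMod 4)) :=
  Subgroup.zpowers (DihedralGroup.r 2, Multiplicative.ofAdd 2)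

instance amalgamatedInvolution_normal : amalgamatedInvolution.Normal := by
  have hc : ∀ g : DihedralGroup 4 × Multiplicative (ZMod 4),
      g * (DihedralGroup.r 2, Multiplicative.ofAdd 2) =
        (DihedralGroup.r 2, Multiplicative.ofAdd 2) * g := by
    rintro ⟨a | a, b⟩ <;> revert a b <;> decide
  refine ⟨?_⟩
  rintro n ⟨z, rfl⟩ g
  have h := (Commute.zpow_right (hc g) z).eq
  exact ⟨z, by simp only; rw [h, mul_inv_cancel_right]⟩

/-- The central product `D₄ ⋎ C₄` of order `16`: the quotient of `D₄ × C₄` identifying the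
central involution of `D₄` with the involution of `C₄`. -/
abbrev CentralProductD4C4 : Type :=
  (DihedralGroup 4 × Multiplicative (ZMod 4)) ⧸ amalgamatedInvolution

/-! Let `G = Gal(M/ℚ)`, of order 16, and let `N = Gal(M/k)`, quaternion of index two. As `M/k` is
unramified at finite primes, every inertia group of `M/ℚ` meets `N` trivially, so it has order at
most two and its nontrivial element is an involution outside `N`. By Minkowski's theorem the inertia
groups generate `G`, hence so do these involutions (`closure_involutions_eq_top`). Because `N` is
not commutative, some such involution `t` inverts two noncommuting elements `u, v` of `N`. Then `c =
uvt` centralizes `N` and `c² = u²`, which makes `G` the central product of `N` with `⟨c⟩`, and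
equally of `⟨u, vc⟩ ≃ D₄` with `⟨c⟩ ≃ C₄`.

This group has three quadratic characters `χᵢ` with `ker (χ₀χ₁χ₂) = N`. An involution is nontrivial
under at most one of them (`character_of_sq`), and whatever commutes with an involution on which `χᵢ
= -1` satisfies `χᵢ₊₁ = χᵢ₊₂` (`character_of_commute`). Let `ℚ(√mᵢ)` be the field cut out by `χᵢ`,
with discriminant `dᵢ`. For `p ∣ dᵢ` the inertia generator is an involution with `χᵢ = -1`; hence
the `dᵢ` are pairwise coprime, and `k = ℚ(√(m₀m₁m₂))` has discriminant `d₀d₁d₂`. Complex conjugation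
squares to one, so at most one `dᵢ` is negative. The decomposition group at `p` commutes with the
inertia generator, so it fixes `√(mᵢ₊₁mᵢ₊₂)`; thus `p` splits in that field and the symbol is `1`.
-/

namespace QuaternionGroup

/-- Every noncommuting pair can play the role of `i, j`, so the pair supplied by the involutions
needs no normalization. -/
lemma sq_eq_sq_of_not_commute : ∀ x y : QuaternionGroup 2, x * y ≠ y * x →
    x ^ 4 = 1 ∧ y ^ 2 = x ^ 2 ∧ y * x = x⁻¹ * y := by
  decide

set_option maxRecDepth 4000 in
lemma exists_eq_pow_mul_pow_of_not_commute : ∀ x y : QuaternionGroup 2, x * y ≠ y * x →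
    ∀ n, ∃ i : Fin 4, ∃ j : Fin 2, n = x ^ (i : ℕ) * y ^ (j : ℕ) := by
  decide

end QuaternionGroup

/-! ### Index-two quaternion subgroups and outer involutions -/

section InvolutionGeneration

variable {G : Type*} [Group G] (N : Subgroup G)

/-- If a group is generated by the involutions outside a noncommutative subgroup of index
two, then some involutions `t`, `u * t`, `v * t` outside it have `u * v ≠ v * u`. -/
lemma exists_involutions_of_closure_eq_top (hN : N.index = 2)
    (hcomm : ∃ x ∈ N, ∃ y ∈ N, x * y ≠ y * x)
    (hgen : Subgroup.closure {g : G | g ^ 2 = 1 ∧ g ∉ N} = ⊤) :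
    ∃ t u v : G, t ∉ N ∧ u ∈ N ∧ v ∈ N ∧ t ^ 2 = 1 ∧ (u * t) ^ 2 = 1 ∧ (v * t) ^ 2 = 1 ∧
      u * v ≠ v * u := by
  obtain ⟨x, hx, y, hy, hxy⟩ := hcomm
  by_contra! H
  obtain ⟨t, ht2, ht⟩ : ∃ t : G, t ^ 2 = 1 ∧ t ∉ N := by
    by_contra! h
    have h0 : {g : G | g ^ 2 = 1 ∧ g ∉ N} = ∅ := by
      ext g; simpa using h g
    rw [h0, Subgroup.closure_empty] at hgen
    have h1 : ∀ g : G, g = 1 := fun g => by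
      have : g ∈ (⊥ : Subgroup G) := hgen ▸ Subgroup.mem_top g
      simpa using this
    exact hxy (by rw [h1 x, h1 y])
  have htt : t * t = 1 := by rw [← sq, ht2]
  set A : Set G := {a | a ∈ N ∧ (a * t) ^ 2 = 1} with hA
  set K := Subgroup.closure A with hK
  have hKN : K ≤ N := (Subgroup.closure_le _).2 fun a ha => ha.1
  have hKcomm : ∀ a ∈ K, ∀ b ∈ K, a * b = b * a := by
    have := Subgroup.isMulCommutative_closure (k := A) fun a ha b hb =>
      H t a b ht ha.1 hb.1 ht2 ha.2 hb.2
    intro a ha b hb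
    exact congrArg Subtype.val (mul_comm' (⟨a, ha⟩ : Subgroup.closure A) ⟨b, hb⟩)
  -- Conjugation by `t` inverts each generator of `K`, since `(a * t) ^ 2 = 1`.
  have hconj : ∀ a ∈ K, t * a * t ∈ K := by
    intro a ha
    induction ha using Subgroup.closure_induction with
    | mem a ha =>
      have h : a * (t * a * t) = 1 := by
        have := ha.2; rw [sq] at this; simpa [mul_assoc] using this
      rw [← inv_eq_of_mul_eq_one_right h]
      exact K.inv_mem (Subgroup.subset_closure ha)
    | one => simp [htt]
    | mul a b _ _ iha ihb =>
      have : t * (a * b) * t = (t * a * t) * (t * b * t) := by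
        calc t * (a * b) * t = t * a * (1 * b * t) := by group
          _ = t * a * (t * t * b * t) := by rw [htt]
          _ = _ := by group
      rw [this]; exact K.mul_mem iha ihb
    | inv a _ ih =>
      have : t * a⁻¹ * t = (t * a * t)⁻¹ := by
        have hti : t⁻¹ = t := inv_eq_of_mul_eq_one_right htt
        simp [mul_inv_rev, hti, mul_assoc]
      rw [this]; exact K.inv_mem ih
  -- `K ∪ Kt` is a subgroup containing all the generating involutions. Hence it is `G`, which forces
  -- `N = K` to be commutative.
  have key : ∀ g : G, g ∈ K ∨ g * t ∈ K := by
    intro g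
    have hg : g ∈ Subgroup.closure {g : G | g ^ 2 = 1 ∧ g ∉ N} := hgen ▸ Subgroup.mem_top g
    induction hg using Subgroup.closure_induction with
    | mem s hs =>
      right
      refine Subgroup.subset_closure ⟨?_, ?_⟩
      · rw [Subgroup.mul_mem_iff_of_index_two hN]
        exact iff_of_false hs.2 ht
      · rw [mul_assoc, htt, mul_one, hs.1]
    | one => exact Or.inl K.one_mem
    | mul a b _ _ iha ihb =>
      rcases iha with ha | ha <;> rcases ihb with hb | hb
      · exact Or.inl (K.mul_mem ha hb)
      · exact Or.inr (by rw [mul_assoc]; exact K.mul_mem ha hb)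
      · right
        have : a * b * t = (a * t) * (t * b * t) := by
          calc a * b * t = a * 1 * b * t := by group
            _ = a * (t * t) * b * t := by rw [htt]
            _ = _ := by group
        rw [this]; exact K.mul_mem ha (hconj b hb)
      · left
        have : a * b = (a * t) * (t * (b * t) * t) := by
          calc a * b = a * 1 * b * 1 := by group
            _ = a * (t * t) * b * (t * t) := by rw [htt]
            _ = _ := by group
        rw [this]; exact K.mul_mem ha (hconj _ hb)
    | inv a _ ih =>
      have hti : t⁻¹ = t := inv_eq_of_mul_eq_one_right htt
      rcases ih with ha | ha
      · exact Or.inl (K.inv_mem ha)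
      · right
        have : a⁻¹ * t = t * (a * t)⁻¹ * t := by
          rw [mul_inv_rev, hti, ← mul_assoc, htt, one_mul]
        rw [this]; exact hconj _ (K.inv_mem ha)
  have hNK : ∀ n ∈ N, n ∈ K := by
    intro n hn
    refine (key n).resolve_right fun h => ?_
    have := hKN h
    rw [Subgroup.mul_mem_iff_of_index_two hN] at this
    exact ht (this.1 hn)
  exact hxy (hKcomm x (hNK x hx) y (hNK y hy))

/-- Generators `u`, `v` of a quaternion subgroup `N` of index two and an element `c ∉ N`
centralizing it with `c ^ 2` the central involution of `N`. -/
structure IsCentralQuaternionTriple (u v c : G) : Prop where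
  index : N.index = 2
  mem_left : u ∈ N
  mem_right : v ∈ N
  notMem : c ∉ N
  pow_four : u ^ 4 = 1
  right_sq : v ^ 2 = u ^ 2
  central_sq : c ^ 2 = u ^ 2
  mul_eq : v * u = u⁻¹ * v
  commute_left : Commute c u
  commute_right : Commute c v
  exists_eq : ∀ n ∈ N, ∃ i j : ℕ, n = u ^ i * v ^ j

/-- Conjugation by `t` inverts `u` and `v`, and so does conjugation by `u * v`; hence `u * v * t`
centralizes both. Its square is the commutator of `u` and `v`, namely `u ^ 2`. -/
lemma exists_isCentralQuaternionTriple (hN : N.index = 2) (e : N ≃* QuaternionGroup 2)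
    (hgen : Subgroup.closure {g : G | g ^ 2 = 1 ∧ g ∉ N} = ⊤) :
    ∃ u v c : G, IsCentralQuaternionTriple N u v c := by
  obtain ⟨t, u, v, ht, hu, hv, ht2, hut, hvt, huv⟩ :=
    exists_involutions_of_closure_eq_top N hN
      ⟨e.symm (.a 1), (e.symm (.a 1)).2, e.symm (.xa 0), (e.symm (.xa 0)).2, fun h => by
        have h' : e.symm (.a 1) * e.symm (.xa 0) = e.symm (.xa 0) * e.symm (.a 1) :=
          Subtype.ext h
        rw [← map_mul, ← map_mul] at h'
        exact absurd (e.symm.injective h') (by decide)⟩ hgen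
  have hne : e ⟨u, hu⟩ * e ⟨v, hv⟩ ≠ e ⟨v, hv⟩ * e ⟨u, hu⟩ := by
    rw [← map_mul, ← map_mul]
    exact fun h => huv (congrArg Subtype.val (e.injective h))
  obtain ⟨h2, h3, h4⟩ := QuaternionGroup.sq_eq_sq_of_not_commute _ _ hne
  have pull : ∀ a b : N, e a = e b → (a : G) = b := fun a b h =>
    congrArg Subtype.val (e.injective h)
  have h2' : u ^ 4 = 1 := pull (⟨u, hu⟩ ^ 4) 1 (by rw [map_pow, h2, map_one])
  have h3' : v ^ 2 = u ^ 2 := pull (⟨v, hv⟩ ^ 2) (⟨u, hu⟩ ^ 2) (by rw [map_pow, h3, map_pow])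
  have h4' : v * u = u⁻¹ * v :=
    pull (⟨v, hv⟩ * ⟨u, hu⟩) (⟨u, hu⟩⁻¹ * ⟨v, hv⟩) (by rw [map_mul, h4, map_mul, map_inv])
  have htt : t * t = 1 := by rw [← sq, ht2]
  have htu : t * u = u⁻¹ * t := by
    have : u * (t * u * t) = 1 := by rw [sq] at hut; simpa [mul_assoc] using hut
    have := eq_inv_of_mul_eq_one_right this
    calc t * u = t * u * t * t := by rw [mul_assoc, mul_assoc, htt, mul_one]
      _ = _ := by rw [this]
  have htv : t * v = v⁻¹ * t := by
    have : v * (t * v * t) = 1 := by rw [sq] at hvt; simpa [mul_assoc] using hvt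
    have := eq_inv_of_mul_eq_one_right this
    calc t * v = t * v * t * t := by rw [mul_assoc, mul_assoc, htt, mul_one]
      _ = _ := by rw [this]
  have hvu' : v * u⁻¹ = u * v := by
    calc v * u⁻¹ = u * (u⁻¹ * v) * u⁻¹ := by group
      _ = u * (v * u) * u⁻¹ := by rw [h4']
      _ = _ := by group
  refine ⟨u, v, u * v * t, hN, hu, hv, ?_, h2', h3', ?_, h4', ?_, ?_, ?_⟩
  · rw [Subgroup.mul_mem_iff_of_index_two hN]
    have := N.mul_mem hu hv
    tauto
  · calc (u * v * t) ^ 2 = u * v * (t * u) * v * t := by rw [sq]; group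
      _ = u * v * u⁻¹ * (t * v) * t := by rw [htu]; group
      _ = u * (v * u⁻¹) * v⁻¹ * (t * t) := by rw [htv]; group
      _ = u ^ 2 := by rw [hvu', htt, sq]; group
  · show u * v * t * u = u * (u * v * t)
    calc u * v * t * u = u * v * (t * u) := by group
      _ = u * (v * u⁻¹) * t := by rw [htu]; group
      _ = _ := by rw [hvu']; group
  · show u * v * t * v = v * (u * v * t)
    calc u * v * t * v = u * v * (t * v) := by group
      _ = u * t := by rw [htv]; group
      _ = u⁻¹ * (u * u) * t := by group
      _ = u⁻¹ * v ^ 2 * t := by rw [h3', sq]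
      _ = (u⁻¹ * v) * v * t := by rw [sq]; group
      _ = _ := by rw [← h4']; group
  · intro n hn
    obtain ⟨i, j, hij⟩ := QuaternionGroup.exists_eq_pow_mul_pow_of_not_commute _ _ hne (e ⟨n, hn⟩)
    refine ⟨i, j, pull ⟨n, hn⟩ (⟨u, hu⟩ ^ (i : ℕ) * ⟨v, hv⟩ ^ (j : ℕ)) ?_⟩
    rw [hij, map_mul, map_pow, map_pow]

end InvolutionGeneration

/-! ### Homomorphisms out of cyclic and dihedral groups -/

lemma zpow_zmodCast_eq {G : Type*} [Group G] {n : ℕ} {x : G} (hx : x ^ n = 1) {a : ZMod n} {b : ℤ}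
    (h : a = (b : ZMod n)) : x ^ (a.cast : ℤ) = x ^ b := by
  rw [← mul_inv_eq_one, ← zpow_neg, ← zpow_add]
  obtain ⟨c, hc⟩ : (n : ℤ) ∣ (a.cast : ℤ) + -b := by
    rw [← ZMod.intCast_zmod_eq_zero_iff_dvd]
    subst h
    simp
  rw [hc, zpow_mul, zpow_natCast, hx, one_zpow]

/-- The homomorphism from a cyclic group determined by the image of a generator. -/
def cyclicLiftHom {G : Type*} [Group G] (n : ℕ) (x : G) (hx : x ^ n = 1) :
    Multiplicative (ZMod n) →* G :=
  MonoidHom.mk' (fun g => x ^ (g.toAdd.cast : ℤ)) fun a b => by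
    rw [← zpow_add]; exact zpow_zmodCast_eq hx (by simp)

namespace DihedralGroup

/-- The homomorphism from a dihedral group determined by images of a rotation and a reflection. -/
def liftHom {G : Type*} [Group G] (n : ℕ) (x y : G) (hx : x ^ n = 1) (hy : y * y = 1)
    (hxy : y * x = x⁻¹ * y) : DihedralGroup n →* G :=
  have hyx (a : ℤ) : y * x ^ a = x ^ (-a) * y := by
    have : SemiconjBy y (x ^ a) (x⁻¹ ^ a) := SemiconjBy.zpow_right hxy a
    rw [this.eq, inv_zpow']
  MonoidHom.mk'
    (fun g => match g with
      | r i => x ^ (i.cast : ℤ)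
      | sr i => y * x ^ (i.cast : ℤ))
    (by
      rintro (i | i) (j | j)
      · change x ^ ((i + j).cast : ℤ) = x ^ (i.cast : ℤ) * x ^ (j.cast : ℤ)
        rw [← zpow_add]; exact zpow_zmodCast_eq hx (by simp)
      · change y * x ^ ((j - i).cast : ℤ) = x ^ (i.cast : ℤ) * (y * x ^ (j.cast : ℤ))
        have := hyx (-(i.cast : ℤ))
        rw [neg_neg] at this
        rw [← mul_assoc, ← this, mul_assoc, ← zpow_add]
        congr 1; exact zpow_zmodCast_eq hx (by simp; ring)
      · change y * x ^ ((i + j).cast : ℤ) = y * x ^ (i.cast : ℤ) * x ^ (j.cast : ℤ)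
        rw [mul_assoc, ← zpow_add]
        congr 1; exact zpow_zmodCast_eq hx (by simp)
      · change x ^ ((j - i).cast : ℤ) = y * x ^ (i.cast : ℤ) * (y * x ^ (j.cast : ℤ))
        rw [hyx, mul_assoc, ← mul_assoc y, hy, one_mul, ← zpow_add]
        exact zpow_zmodCast_eq hx (by simp; ring))

/-- The character of the dihedral group of order `8` that is `-1` on the generating rotation and
`1` on `sr 0`. -/
def rotationCharacter : DihedralGroup 4 →* ℤˣ :=
  MonoidHom.mk' (fun g => match g with | r i => (-1) ^ i.val | sr i => (-1) ^ i.val) (by decide)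

/-- The character of the dihedral group of order `8` with kernel the rotations. -/
def reflectionCharacter : DihedralGroup 4 →* ℤˣ :=
  MonoidHom.mk' (fun g => match g with | r _ => 1 | sr _ => -1) (by decide)

end DihedralGroup

/-- The nontrivial quadratic character of the cyclic group of order `4`. -/
def cyclicFourCharacter : Multiplicative (ZMod 4) →* ℤˣ :=
  MonoidHom.mk' (fun g => (-1) ^ (g.toAdd : ZMod 4).val) (by decide)

/-! ### Quadratic characters of the central product -/

namespace CentralProductD4C4

open DihedralGroup

/-- Three characters of `D₄ × C₄`, trivial on the amalgamated involution and independent. -/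
def coverCharacter : Fin 3 → (DihedralGroup 4 × Multiplicative (ZMod 4) →* ℤˣ) :=
  ![cyclicFourCharacter.comp (MonoidHom.snd _ _),
    (rotationCharacter.comp (MonoidHom.fst _ _) * reflectionCharacter.comp (MonoidHom.fst _ _)) *
      cyclicFourCharacter.comp (MonoidHom.snd _ _),
    rotationCharacter.comp (MonoidHom.fst _ _) * cyclicFourCharacter.comp (MonoidHom.snd _ _)]

lemma mem_amalgamatedInvolution_iff (x : DihedralGroup 4 × Multiplicative (ZMod 4)) :
    x ∈ amalgamatedInvolution ↔ x = 1 ∨ x = (r 2, Multiplicative.ofAdd 2) := by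
  have h2 : ((r 2, Multiplicative.ofAdd 2) : DihedralGroup 4 × Multiplicative (ZMod 4)) ^ 2 = 1 := by
    decide
  constructor
  · rintro ⟨z, rfl⟩
    obtain ⟨w, rfl | rfl⟩ := Int.even_or_odd' z
    · left
      simp only [zpow_mul]
      rw [zpow_ofNat, h2, one_zpow]
    · right
      simp only [zpow_add, zpow_mul]
      rw [zpow_ofNat, h2, one_zpow, one_mul, zpow_one]
  · rintro (rfl | rfl)
    · exact one_mem _
    · exact Subgroup.mem_zpowers _

lemma card : Nat.card CentralProductD4C4 = 16 := by
  have h1 := Subgroup.card_eq_card_quotient_mul_card_subgroup amalgamatedInvolution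
  have h2 : Nat.card amalgamatedInvolution = 2 := by
    rw [amalgamatedInvolution, Nat.card_zpowers]
    exact orderOf_eq_prime (by decide) (by decide)
  rw [h2, Nat.card_prod, DihedralGroup.nat_card, Nat.card_congr Multiplicative.toAdd,
    Nat.card_zmod] at h1
  change Nat.card ((DihedralGroup 4 × Multiplicative (ZMod 4)) ⧸ amalgamatedInvolution) = 16
  omega

/-- The characters of `D₄ ⋎ C₄` induced by `coverCharacter`. -/
def character (i : Fin 3) : CentralProductD4C4 →* ℤˣ :=
  QuotientGroup.lift _ (coverCharacter i) fun x hx => by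
    rw [mem_amalgamatedInvolution_iff] at hx
    revert i
    rcases hx with rfl | rfl <;> decide

/-- An equation in the quotient is stated on `D₄ × C₄` as membership in the two-element amalgamated
subgroup, so that a finite check decides it. -/
lemma coverCharacter_of_sq : ∀ x : DihedralGroup 4 × Multiplicative (ZMod 4),
    (x ^ 2 = 1 ∨ x ^ 2 = (r 2, Multiplicative.ofAdd 2)) →
    ∀ i j : Fin 3, i ≠ j → coverCharacter i x = 1 ∨ coverCharacter j x = 1 := by
  decide

set_option synthInstance.maxHeartbeats 400000 in
set_option synthInstance.maxSize 1000 in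
lemma coverCharacter_of_commutator : ∀ x y : DihedralGroup 4 × Multiplicative (ZMod 4),
    (x ^ 2 = 1 ∨ x ^ 2 = (r 2, Multiplicative.ofAdd 2)) →
    ((x * y)⁻¹ * (y * x) = 1 ∨ (x * y)⁻¹ * (y * x) = (r 2, Multiplicative.ofAdd 2)) →
    ∀ i : Fin 3, coverCharacter i x ≠ 1 → coverCharacter (i + 1) y = coverCharacter (i + 2) y := by
  decide

/-- Applied to inertia generators it gives coprime discriminants; applied to complex conjugation it
gives the signs. -/
lemma character_of_sq (x : CentralProductD4C4) (hx : x ^ 2 = 1) (i j : Fin 3) (hij : i ≠ j) :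
    character i x = 1 ∨ character j x = 1 := by
  obtain ⟨x, rfl⟩ := QuotientGroup.mk_surjective x
  exact coverCharacter_of_sq x
    ((mem_amalgamatedInvolution_iff _).1 ((QuotientGroup.eq_one_iff _).1 hx)) i j hij

/-- For such an `x`, the commutator with `x` takes values in a group of order two and, as a function
of `y`, is the product of the other two characters. -/
lemma character_of_commute (x y : CentralProductD4C4) (hx : x ^ 2 = 1) (hxy : x * y = y * x)
    (i : Fin 3) (hi : character i x ≠ 1) : character (i + 1) y = character (i + 2) y := by
  obtain ⟨x, rfl⟩ := QuotientGroup.mk_surjective x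
  obtain ⟨y, rfl⟩ := QuotientGroup.mk_surjective y
  exact coverCharacter_of_commutator x y
    ((mem_amalgamatedInvolution_iff _).1 ((QuotientGroup.eq_one_iff _).1 hx))
    ((mem_amalgamatedInvolution_iff _).1 (QuotientGroup.eq.1 hxy)) i hi

lemma character_ne_one (i : Fin 3) : character i ≠ 1 := by
  intro h
  have h' : ∀ x, coverCharacter i x = 1 := fun x => DFunLike.congr_fun h (QuotientGroup.mk x)
  clear h
  revert i
  decide

end CentralProductD4C4

/-! ### Identification with the central product -/

namespace IsCentralQuaternionTriple

open DihedralGroup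

variable {G : Type*} [Group G] {N : Subgroup G} {u v c : G}

/-- Multiplying `v` by the commuting `c` of the same square turns it into an involution that still
inverts `u`: a reflection for the rotation `u`. -/
lemma mul_mul_self (h : IsCentralQuaternionTriple N u v c) : v * c * (v * c) = 1 := by
  rw [h.commute_right.mul_mul_mul_comm, ← sq, ← sq, h.right_sq, h.central_sq, ← pow_add,
    h.pow_four]

lemma mul_mul_eq (h : IsCentralQuaternionTriple N u v c) : v * c * u = u⁻¹ * (v * c) := by
  rw [mul_assoc, h.commute_left.eq, ← mul_assoc, h.mul_eq, mul_assoc]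

lemma central_pow_four (h : IsCentralQuaternionTriple N u v c) : c ^ 4 = 1 := by
  rw [show 4 = 2 * 2 from rfl, pow_mul, h.central_sq, ← pow_mul, h.pow_four]

/-- The homomorphism from `D₄ × C₄` sending `r 1`, `sr 0` and the generator of `C₄` to `u`, `v * c`
and `c`. -/
def coverHom (h : IsCentralQuaternionTriple N u v c) :
    DihedralGroup 4 × Multiplicative (ZMod 4) →* G :=
  (liftHom 4 u (v * c) h.pow_four h.mul_mul_self h.mul_mul_eq).noncommCoprod
    (cyclicLiftHom 4 c h.central_pow_four) (by
      rintro (i | i) j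
      · exact (h.commute_left.symm.zpow_zpow _ _)
      · exact ((h.commute_right.symm.mul_left (Commute.refl c)).zpow_right _).mul_left
          (h.commute_left.symm.zpow_zpow _ _))

lemma coverHom_r (h : IsCentralQuaternionTriple N u v c) (i : ZMod 4) (j : ZMod 4) :
    h.coverHom (r i, Multiplicative.ofAdd j) = u ^ (i.cast : ℤ) * c ^ (j.cast : ℤ) := rfl

lemma coverHom_sr (h : IsCentralQuaternionTriple N u v c) (i : ZMod 4) (j : ZMod 4) :
    h.coverHom (sr i, Multiplicative.ofAdd j) = v * c * u ^ (i.cast : ℤ) * c ^ (j.cast : ℤ) := rfl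

lemma coverHom_surjective (h : IsCentralQuaternionTriple N u v c) :
    Function.Surjective h.coverHom := by
  have hu : u ∈ h.coverHom.range := ⟨(r 1, Multiplicative.ofAdd 0), by
    rw [coverHom_r]; change u ^ (1 : ℤ) * c ^ (0 : ℤ) = u; simp⟩
  have hc : c ∈ h.coverHom.range := ⟨(r 0, Multiplicative.ofAdd 1), by
    rw [coverHom_r]; change u ^ (0 : ℤ) * c ^ (1 : ℤ) = c; simp⟩
  have hvc : v * c ∈ h.coverHom.range := ⟨(sr 0, Multiplicative.ofAdd 0), by
    rw [coverHom_sr]; change v * c * u ^ (0 : ℤ) * c ^ (0 : ℤ) = v * c; simp⟩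
  have hv : v ∈ h.coverHom.range := (Subgroup.mul_mem_cancel_right _ hc).1 hvc
  have hN : ∀ n ∈ N, n ∈ h.coverHom.range := by
    intro n hn
    obtain ⟨i, j, rfl⟩ := h.exists_eq n hn
    exact mul_mem (pow_mem hu _) (pow_mem hv _)
  intro g
  change g ∈ h.coverHom.range
  by_cases hg : g ∈ N
  · exact hN g hg
  · refine (Subgroup.mul_mem_cancel_right _ hc).1 (hN _ ?_)
    rw [Subgroup.mul_mem_iff_of_index_two h.index]
    exact iff_of_false hg h.notMem

/-- Both `c` and `v * c` lie outside `N` while `u` lies inside, so membership is read off from the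
product of the reflection character and the `C₄` character; the three cover characters multiply to
exactly this. It later places `√(m₀m₁m₂)` in `k`. -/
lemma coverHom_mem_iff (h : IsCentralQuaternionTriple N u v c)
    (x : DihedralGroup 4 × Multiplicative (ZMod 4)) : h.coverHom x ∈ N ↔
      CentralProductD4C4.coverCharacter 0 x * CentralProductD4C4.coverCharacter 1 x *
        CentralProductD4C4.coverCharacter 2 x = 1 := by
  have hc2 : c ^ 2 ∈ N := h.central_sq ▸ pow_mem h.mem_left 2
  have hcz : ∀ j : ZMod 4, c ^ (j.cast : ℤ) ∈ N ↔ cyclicFourCharacter (Multiplicative.ofAdd j) = 1 := by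
    intro j
    fin_cases j
    · exact iff_of_true (by change c ^ (0 : ℤ) ∈ N; simp) (by decide)
    · exact iff_of_false (by change ¬ c ^ (1 : ℤ) ∈ N; simpa using h.notMem) (by decide)
    · exact iff_of_true (by change c ^ ((2 : ℕ) : ℤ) ∈ N; rwa [zpow_natCast]) (by decide)
    · refine iff_of_false ?_ (by decide)
      change ¬ c ^ ((3 : ℕ) : ℤ) ∈ N
      rw [zpow_natCast, pow_succ, Subgroup.mul_mem_cancel_left _ hc2]
      exact h.notMem
  have hvc : v * c ∉ N := by
    rw [Subgroup.mul_mem_cancel_left _ h.mem_right]; exact h.notMem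
  obtain ⟨i | i, j⟩ := x
  · have e1 : ∀ (i : ZMod 4) (j : Multiplicative (ZMod 4)), cyclicFourCharacter j =
        CentralProductD4C4.coverCharacter 0 (r i, j) * CentralProductD4C4.coverCharacter 1 (r i, j) *
        CentralProductD4C4.coverCharacter 2 (r i, j) := by decide
    rw [← e1, ← ofAdd_toAdd j, coverHom_r,
      Subgroup.mul_mem_cancel_left _ (zpow_mem h.mem_left _), hcz]
  · have e1 : ∀ (i : ZMod 4) (j : Multiplicative (ZMod 4)),
        (CentralProductD4C4.coverCharacter 0 (sr i, j) *
          CentralProductD4C4.coverCharacter 1 (sr i, j) *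
          CentralProductD4C4.coverCharacter 2 (sr i, j) = 1) ↔ ¬ cyclicFourCharacter j = 1 := by
      decide
    rw [e1, ← ofAdd_toAdd j, coverHom_sr, Subgroup.mul_mem_iff_of_index_two h.index, hcz,
      Subgroup.mul_mem_cancel_right _ (zpow_mem h.mem_left _)]
    tauto

lemma exists_mulEquiv (h : IsCentralQuaternionTriple N u v c) (hG : Nat.card G = 16) :
    ∃ e : G ≃* CentralProductD4C4, ∀ g, g ∈ N ↔ CentralProductD4C4.character 0 (e g) *
      CentralProductD4C4.character 1 (e g) * CentralProductD4C4.character 2 (e g) = 1 := by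
  have hker : ∀ x ∈ amalgamatedInvolution, h.coverHom x = 1 := by
    intro x hx
    rcases (CentralProductD4C4.mem_amalgamatedInvolution_iff x).1 hx with rfl | rfl
    · exact map_one _
    · rw [coverHom_r]
      change u ^ ((2 : ℕ) : ℤ) * c ^ ((2 : ℕ) : ℤ) = 1
      rw [zpow_natCast, zpow_natCast, h.central_sq, ← pow_add, h.pow_four]
  let f : CentralProductD4C4 →* G := QuotientGroup.lift amalgamatedInvolution h.coverHom hker
  have hf : Function.Surjective f := QuotientGroup.lift_surjective_of_surjective _ _
    h.coverHom_surjective hker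
  have : Finite CentralProductD4C4 := Nat.finite_of_card_ne_zero (by rw [CentralProductD4C4.card]; decide)
  have hbij : Function.Bijective f :=
    (Nat.bijective_iff_surjective_and_card f).2 ⟨hf, by rw [CentralProductD4C4.card, hG]⟩
  refine ⟨(MulEquiv.ofBijective f hbij).symm, fun g => ?_⟩
  obtain ⟨x, rfl⟩ := (MulEquiv.ofBijective f hbij).surjective g
  rw [MulEquiv.symm_apply_apply]
  obtain ⟨x, rfl⟩ := QuotientGroup.mk_surjective x
  exact h.coverHom_mem_iff x

end IsCentralQuaternionTriple

/-! ### Inertia and decomposition groups -/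

section Inertia

variable {M : Type*} [Field M] [NumberField M]

open scoped Pointwise

lemma inertia_eq_bot_of_isUnramifiedAt (k : Type*) [Field k] [NumberField k] [Algebra k M]
    [IsGalois k M] (P : Ideal (𝓞 M)) [P.IsPrime] [Algebra.IsUnramifiedAt (𝓞 k) P] :
    P.inertia Gal(M/k) = ⊥ := by
  have h := Ideal.card_inertia_eq_ramificationIdxIn (G := Gal(M/k)) (P.under (𝓞 k)) P
  rw [Ideal.ramificationIdxIn_eq_ramificationIdx _ P Gal(M/k),
    Ideal.ramificationIdx_eq_one_iff.2 inferInstance] at h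
  exact Subgroup.eq_bot_of_card_eq _ h

/-- The inertia group over `ℚ` is then contained in the one over `F`. Their orders are ramification
indices, so multiplicativity in the tower leaves index one for `F/ℚ`. -/
lemma isUnramifiedAt_under_of_inertia_le [IsGalois ℚ M] (F : IntermediateField ℚ M)
    (P : Ideal (𝓞 M)) [P.IsPrime]
    (h : P.inertia Gal(M/ℚ) ≤ F.fixingSubgroup) :
    Algebra.IsUnramifiedAt ℤ (P.under (𝓞 F)) := by
  have h1 := Ideal.card_inertia_eq_ramificationIdxIn (G := Gal(M/ℚ)) (P.under ℤ) P
  have h2 := Ideal.card_inertia_eq_ramificationIdxIn (G := Gal(M/F)) (P.under (𝓞 F)) P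
  rw [Ideal.ramificationIdxIn_eq_ramificationIdx _ P Gal(M/ℚ)] at h1
  rw [Ideal.ramificationIdxIn_eq_ramificationIdx _ P Gal(M/F)] at h2
  have h3 := Ideal.ramificationIdx_tower (R := ℤ) (P.under (𝓞 F)) P
  have h4 : Nat.card (P.inertia Gal(M/ℚ)) ≤ Nat.card (P.inertia Gal(M/F)) := by
    let f : P.inertia Gal(M/ℚ) → P.inertia Gal(M/F) := fun g =>
      ⟨IntermediateField.fixingSubgroupEquiv F ⟨g.1, h g.2⟩, fun x => g.2 x⟩
    refine Nat.card_le_card_of_injective f fun a b hab => ?_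
    have := congrArg (fun z => (IntermediateField.fixingSubgroupEquiv F).symm z.1) hab
    simp only [f, MulEquiv.symm_apply_apply] at this
    exact Subtype.ext (Subtype.mk.inj this)
  have hpos : 0 < Nat.card (P.inertia Gal(M/F)) := Nat.card_pos
  have hpos' : 0 < Nat.card (P.inertia Gal(M/ℚ)) := Nat.card_pos
  rw [← Ideal.ramificationIdx_eq_one_iff]
  rw [h1, h2, h3] at *
  nlinarith [Nat.pos_of_mul_pos_right hpos']

/-- The Galois group of a number field over `ℚ` is generated by its inertia groups. -/
lemma eq_top_of_forall_inertia_le [IsGalois ℚ M] (H : Subgroup Gal(M/ℚ))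
    (h : ∀ (P : Ideal (𝓞 M)) [P.IsPrime], P ≠ ⊥ → P.inertia Gal(M/ℚ) ≤ H) : H = ⊤ := by
  have hF : Module.finrank ℚ (IntermediateField.fixedField H) = 1 := by
    by_contra hne
    -- Minkowski: a number field larger than `ℚ` has a ramified prime.
    obtain ⟨Q, hQ, hram⟩ := NumberField.exists_not_isUnramifiedAt_int
      (𝒪 := 𝓞 (IntermediateField.fixedField H)) hne
    obtain ⟨P, hP, hPQ⟩ := Ideal.exists_maximal_ideal_liesOver_of_isIntegral (S := 𝓞 M) Q
    have hP0 : P ≠ ⊥ := Ideal.IsMaximal.ne_bot_of_isIntegral_int P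
    refine hram ?_
    have := isUnramifiedAt_under_of_inertia_le (IntermediateField.fixedField H) P
      (by rw [IntermediateField.fixingSubgroup_fixedField]; exact h P hP0)
    have hu : P.under (𝓞 (IntermediateField.fixedField H)) = Q := hPQ.over.symm
    subst hu
    exact this
  have := IntermediateField.finrank_eq_one_iff.1 hF
  rw [← IntermediateField.fixingSubgroup_fixedField H, this, IntermediateField.fixingSubgroup_bot]

/-- As `F/ℚ` is Galois, one unramified prime above `p` makes all of them unramified, and then `p`
cannot divide the discriminant. -/
lemma not_inertia_le_fixingSubgroup_of_dvd_discr [IsGalois ℚ M] (F : IntermediateField ℚ M)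
    [IsGalois ℚ F] {p : ℕ} (hp : p.Prime) (hpF : (p : ℤ) ∣ NumberField.discr F) (P : Ideal (𝓞 M)) [P.IsPrime]
    (hP : (p : 𝓞 M) ∈ P) : ¬ P.inertia Gal(M/ℚ) ≤ F.fixingSubgroup := by
  intro h
  have hp' : Prime (p : ℤ) := Nat.prime_iff_prime_int.1 hp
  have hun := isUnramifiedAt_under_of_inertia_le F P h
  refine absurd hpF ((NumberField.not_dvd_discr_iff_forall_mem F (𝓞 F) hp').2 fun Q hQ hpQ => ?_)
  have e1 : (P.under (𝓞 F)).LiesOver (.span {(p : ℤ)}) :=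
    (Ideal.liesOver_span_iff Ideal.IsPrime.ne_top' hp').2 (by simpa [Ideal.mem_comap] using hP)
  have e2 : Q.LiesOver (.span {(p : ℤ)}) :=
    (Ideal.liesOver_span_iff Ideal.IsPrime.ne_top' hp').2 hpQ
  rw [← Ideal.ramificationIdx_eq_one_iff] at hun ⊢
  rwa [← Ideal.ramificationIdxIn_eq_ramificationIdx (.span {(p : ℤ)}) _ Gal(F/ℚ)] at hun ⊢

/-- The decomposition group surjects onto the Galois group of the residue extension, so the residue
of `x` lies in the prime field. -/
lemma exists_int_sub_mem_of_stabilizer_fixed [IsGalois ℚ M] {p : ℕ} (hp : p.Prime)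
    (P : Ideal (𝓞 M)) [P.IsPrime] (hP : (p : 𝓞 M) ∈ P) (x : 𝓞 M)
    (hx : ∀ g ∈ MulAction.stabilizer Gal(M/ℚ) P, g • x = x) : ∃ a : ℤ, x - a ∈ P := by
  have hp' : Prime (p : ℤ) := Nat.prime_iff_prime_int.1 hp
  have : P.LiesOver (.span {(p : ℤ)}) :=
    (Ideal.liesOver_span_iff Ideal.IsPrime.ne_top' hp').2 (by simpa using hP)
  have hmax : (Ideal.span {(p : ℤ)}).IsMaximal :=
    PrincipalIdealRing.isMaximal_of_irreducible hp'.irreducible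
  have hPmax : P.IsMaximal := Ideal.IsMaximal.of_liesOver_isMaximal P (.span {(p : ℤ)})
  let := Ideal.Quotient.field (Ideal.span {(p : ℤ)})
  let := Ideal.Quotient.field P
  have hfin : Finite (𝓞 M ⧸ P) := inferInstance
  have hfin' : Finite (ℤ ⧸ Ideal.span {(p : ℤ)}) :=
    Ideal.finiteQuotientOfFreeOfNeBot _ (by simpa using hp.ne_zero)
  have hgal : IsGalois (ℤ ⧸ Ideal.span {(p : ℤ)}) (𝓞 M ⧸ P) := inferInstance
  have hmem : Ideal.Quotient.mk P x ∈ (⊥ : IntermediateField (ℤ ⧸ Ideal.span {(p : ℤ)}) (𝓞 M ⧸ P)) := by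
    rw [IsGalois.mem_bot_iff_fixed]
    intro f
    obtain ⟨g, rfl⟩ := Ideal.Quotient.stabilizerHom_surjective Gal(M/ℚ) (Ideal.span {(p : ℤ)}) P f
    rw [Ideal.Quotient.stabilizerHom_apply]
    exact congrArg _ (hx g.1 g.2)
  obtain ⟨a, ha⟩ := IntermediateField.mem_bot.1 hmem
  obtain ⟨a, rfl⟩ := Ideal.Quotient.mk_surjective a
  refine ⟨a, ?_⟩
  rw [← Ideal.Quotient.eq_zero_iff_mem, map_sub, ← ha]
  simp

end Inertia

/-! ### Discriminants of quadratic fields -/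

/-- The discriminant of `ℚ(√m)` for squarefree `m ≠ 1`. -/
def quadraticDiscr (m : ℤ) : ℤ := if m % 4 = 1 then m else 4 * m

section QuadraticDiscr

lemma exists_int_eq_of_squarefree_mul_sq {m : ℤ} (hm : Squarefree m) {b : ℚ} {l : ℤ}
    (h : m * b ^ 2 = l) : ∃ z : ℤ, b = z := by
  have hm0 : m ≠ 0 := hm.ne_zero
  have hint : IsIntegral ℤ ((m : ℚ) * b) := by
    refine IsIntegral.of_pow (n := 2) two_pos ?_
    have : ((m : ℚ) * b) ^ 2 = ((m * l : ℤ) : ℚ) := by push_cast; rw [← h]; ring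
    rw [this]; exact isIntegral_algebraMap (R := ℤ) (A := ℚ)
  obtain ⟨c, hc⟩ := IsIntegrallyClosed.isIntegral_iff.1 hint
  have hc' : (c : ℚ) = m * b := hc
  have hdvd : m ∣ c ^ 2 := ⟨l, by
    have : ((c ^ 2 : ℤ) : ℚ) = ((m * l : ℤ) : ℚ) := by push_cast; rw [hc', ← h]; ring
    exact_mod_cast this⟩
  obtain ⟨z, rfl⟩ := (hm.dvd_pow_iff_dvd two_ne_zero).1 hdvd
  refine ⟨z, ?_⟩
  have : (m : ℚ) ≠ 0 := by exact_mod_cast hm0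
  push_cast at hc'
  exact (mul_left_cancel₀ this hc').symm

lemma not_sq_rat_eq_squarefree {m : ℤ} (hm : Squarefree m) (hm1 : m ≠ 1) (q : ℚ) :
    q ^ 2 ≠ m := by
  intro h
  have hint : IsIntegral ℤ q := by
    refine IsIntegral.of_pow (n := 2) two_pos ?_
    rw [h]; exact isIntegral_algebraMap (R := ℤ) (A := ℚ)
  obtain ⟨z, rfl⟩ := IsIntegrallyClosed.isIntegral_iff.1 hint
  have h' : z ^ 2 = m := by
    have : ((z : ℚ)) ^ 2 = m := h
    exact_mod_cast this
  have hu := hm z ⟨1, by rw [← h']; ring⟩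
  rcases Int.isUnit_iff.1 hu with rfl | rfl <;> exact hm1 (by rw [← h']; norm_num)

variable {F : Type*} [Field F] [NumberField F]

lemma discr_eq_of_forall_exists_int_add_mul [Algebra.IsQuadraticExtension ℚ F] (ω : 𝓞 F)
    (h : ∀ x : 𝓞 F, ∃ a b : ℤ, x = a + b * ω) :
    (NumberField.discr F : ℚ) = 2 * Algebra.trace ℚ F ((ω : F) ^ 2) - Algebra.trace ℚ F ω ^ 2 := by
  have hrank : Module.finrank ℤ (𝓞 F) = 2 := by
    rw [NumberField.RingOfIntegers.rank, Algebra.IsQuadraticExtension.finrank_eq_two ℚ F]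
  have hspan : ⊤ ≤ Submodule.span ℤ (Set.range ![(1 : 𝓞 F), ω]) := by
    intro x _
    obtain ⟨a, b, rfl⟩ := h x
    rw [Matrix.range_cons, Matrix.range_cons, Matrix.range_empty, Set.union_empty,
      Set.singleton_union, Submodule.mem_span_pair]
    exact ⟨a, b, by simp⟩
  have hcard : Fintype.card (Fin 2) = Module.finrank ℤ (𝓞 F) := by rw [hrank, Fintype.card_fin]
  let b : Module.Basis (Fin 2) ℤ (𝓞 F) := basisOfTopLeSpanOfCardEqFinrank _ hspan hcard
  have hb : ⇑b = ![(1 : 𝓞 F), ω] := coe_basisOfTopLeSpanOfCardEqFinrank _ _ _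
  rw [← NumberField.discr_eq_discr F b, hb, Algebra.discr_def, Matrix.det_fin_two]
  simp only [Algebra.traceMatrix_apply, Algebra.traceForm_apply, Matrix.cons_val_zero,
    Matrix.cons_val_one]
  push_cast [Algebra.coe_trace_int]
  have h1 : Algebra.trace ℚ F 1 = 2 := by
    rw [← map_one (algebraMap ℚ F), Algebra.trace_algebraMap,
      Algebra.IsQuadraticExtension.finrank_eq_two ℚ F]
    simp
  simp [h1, sq]

variable {m : ℤ} {θ : F}

lemma trace_eq_zero_of_sq_eq [Algebra.IsQuadraticExtension ℚ F] (hθ : θ ^ 2 = m)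
    (hθ' : ∀ q : ℚ, θ ≠ algebraMap ℚ F q) : Algebra.trace ℚ F θ = 0 := by
  obtain ⟨σ, hσ⟩ : ∃ σ : Gal(F/ℚ), σ θ ≠ θ := by
    by_contra! hcon
    obtain ⟨q, hq⟩ := IntermediateField.mem_bot.1 ((IsGalois.mem_bot_iff_fixed θ).2 hcon)
    exact hθ' q hq.symm
  have hneg : σ θ = -θ := by
    have : (σ θ) ^ 2 = θ ^ 2 := by rw [← map_pow, hθ, map_intCast]
    exact (sq_eq_sq_iff_eq_or_eq_neg.1 this).resolve_left hσ
  have := Algebra.trace_eq_of_algEquiv σ θ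
  rw [hneg, map_neg] at this
  linarith

lemma exists_eq_add_mul_of_isQuadraticExtension [Algebra.IsQuadraticExtension ℚ F]
    (hθ' : ∀ q : ℚ, θ ≠ algebraMap ℚ F q) (x : F) :
    ∃ a b : ℚ, x = algebraMap ℚ F a + algebraMap ℚ F b * θ := by
  have hli : LinearIndependent ℚ ![(1 : F), θ] := by
    rw [LinearIndependent.pair_iff' one_ne_zero]
    intro q hq
    exact hθ' q (by rw [← hq, Algebra.smul_def, mul_one])
  have hs := hli.span_eq_top_of_card_eq_finrank' (by
    rw [Algebra.IsQuadraticExtension.finrank_eq_two ℚ F, Fintype.card_fin])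
  have hx : x ∈ Submodule.span ℚ (Set.range ![(1 : F), θ]) := hs ▸ Submodule.mem_top
  rw [Matrix.range_cons, Matrix.range_cons, Matrix.range_empty, Set.union_empty,
      Set.singleton_union, Submodule.mem_span_pair] at hx
  obtain ⟨a, b, rfl⟩ := hx
  exact ⟨a, b, by simp [Algebra.smul_def]⟩

/-- An integer of `ℚ(√m)` has the form `(A + B√m) / 2` with `A ^ 2 ≡ m * B ^ 2` modulo `4`. -/
lemma exists_two_mul_eq_add_mul [Algebra.IsQuadraticExtension ℚ F] (hm : Squarefree m)
    (hθ : θ ^ 2 = m) (hθ' : ∀ q : ℚ, θ ≠ algebraMap ℚ F q) (x : 𝓞 F) :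
    ∃ A B n : ℤ, 2 * (x : F) = A + B * θ ∧ A ^ 2 - m * B ^ 2 = 4 * n := by
  obtain ⟨a, b, hx⟩ := exists_eq_add_mul_of_isQuadraticExtension hθ' (x : F)
  have hA : ((Algebra.trace ℤ (𝓞 F) x : ℤ) : ℚ) = 2 * a := by
    rw [Algebra.coe_trace_int, hx, map_add, Algebra.trace_algebraMap,
      Algebra.IsQuadraticExtension.finrank_eq_two ℚ F, ← Algebra.smul_def, map_smul,
      trace_eq_zero_of_sq_eq hθ hθ']
    simp
  set A := Algebra.trace ℤ (𝓞 F) x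
  have hAF : (A : F) = 2 * algebraMap ℚ F a := by
    have := congrArg (algebraMap ℚ F) hA
    simpa using this
  -- This is the norm of `x`, whose conjugate is `A - x`.
  have hn : IsIntegral ℤ (a ^ 2 - m * b ^ 2) := by
    have h1 : IsIntegral ℤ ((x : F) * (A - x)) :=
      x.isIntegral_coe.mul ((isIntegral_algebraMap (R := ℤ) (x := A)).sub x.isIntegral_coe)
    have h2 : (x : F) * (A - x) = algebraMap ℚ F (a ^ 2 - m * b ^ 2) := by
      rw [hAF, hx]
      simp only [map_sub, map_mul, map_pow, map_intCast]
      rw [← hθ]; ring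
    rw [h2] at h1
    exact (isIntegral_algebraMap_iff (algebraMap ℚ F).injective).1 h1
  obtain ⟨n, hn⟩ := IsIntegrallyClosed.isIntegral_iff.1 hn
  have hn' : (n : ℚ) = a ^ 2 - m * b ^ 2 := hn
  obtain ⟨B, hB⟩ := exists_int_eq_of_squarefree_mul_sq hm (b := 2 * b) (l := A ^ 2 - 4 * n) (by
    push_cast; rw [hA, hn']; ring)
  refine ⟨A, B, n, ?_, ?_⟩
  · have hBF : (B : F) = 2 * algebraMap ℚ F b := by
      have := congrArg (algebraMap ℚ F) hB
      simpa using this.symm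
    rw [hAF, hBF, hx]; ring
  · have : ((A ^ 2 - m * B ^ 2 : ℤ) : ℚ) = ((4 * n : ℤ) : ℚ) := by
      push_cast; rw [hA, hn', ← hB]; ring
    exact_mod_cast this

/-- Reducing `A ^ 2 - m * B ^ 2 ≡ 0` modulo `4` gives `A ≡ B` modulo `2` if `m ≡ 1`, and `A`, `B`
both even otherwise. An integral basis is accordingly `1, (1 + θ) / 2` or `1, θ`. -/
lemma discr_eq_quadraticDiscr [Algebra.IsQuadraticExtension ℚ F] (hm : Squarefree m)
    (hθ : θ ^ 2 = m) (hθ' : ∀ q : ℚ, θ ≠ algebraMap ℚ F q) :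
    NumberField.discr F = quadraticDiscr m := by
  have htr := trace_eq_zero_of_sq_eq hθ hθ'
  have htc : ∀ q : ℚ, Algebra.trace ℚ F (algebraMap ℚ F q) = 2 * q := fun q => by
    rw [Algebra.trace_algebraMap, Algebra.IsQuadraticExtension.finrank_eq_two ℚ F]; simp
  have hθint : IsIntegral ℤ θ := by
    refine IsIntegral.of_pow (n := 2) two_pos ?_
    rw [hθ]; exact isIntegral_algebraMap (R := ℤ) (A := F)
  rw [quadraticDiscr]
  split_ifs with hm4
  · obtain ⟨s, hs⟩ : ∃ s : ℤ, m = 4 * s + 1 := ⟨m / 4, by omega⟩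
    have hω : IsIntegral ℤ ((1 + θ) / 2) := by
      refine ⟨Polynomial.X ^ 2 - Polynomial.X - Polynomial.C s, by monicity!, ?_⟩
      have : (m : F) = 4 * s + 1 := by rw [hs]; push_cast; ring
      simp only [Polynomial.eval₂_sub, Polynomial.eval₂_pow, Polynomial.eval₂_X,
        Polynomial.eval₂_C]
      rw [algebraMap_int_eq, eq_intCast]
      linear_combination (1 / 4 : F) * hθ + (1 / 4 : F) * this
    let ω : 𝓞 F := ⟨(1 + θ) / 2, hω⟩
    have hωc : (ω : F) = (1 + θ) / 2 := rfl
    have hd := discr_eq_of_forall_exists_int_add_mul ω fun x => by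
      obtain ⟨A, B, n, hx, hn⟩ := exists_two_mul_eq_add_mul hm hθ hθ' x
      obtain ⟨c, hc⟩ : (2 : ℤ) ∣ A - B := by
        have h2 : (2 : ℤ) ∣ A ^ 2 - B ^ 2 := ⟨2 * n + 2 * s * B ^ 2, by
          rw [hs] at hn; linear_combination hn⟩
        rcases Int.even_or_odd A with hA | hA <;> rcases Int.even_or_odd B with hB | hB
        · exact (hA.sub hB).two_dvd
        · exact absurd h2 (by
            rw [← even_iff_two_dvd, Int.not_even_iff_odd]
            exact (hA.pow_of_ne_zero two_ne_zero).sub_odd hB.pow)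
        · exact absurd h2 (by
            rw [← even_iff_two_dvd, Int.not_even_iff_odd]
            exact hA.pow.sub_even (hB.pow_of_ne_zero two_ne_zero))
        · exact (hA.sub_odd hB).two_dvd
      refine ⟨c, B, NumberField.RingOfIntegers.ext ?_⟩
      have hcF : (A : F) - B = 2 * c := by exact_mod_cast congrArg (Int.cast : ℤ → F) hc
      simp only [map_add, map_mul, map_intCast]
      rw [show algebraMap (𝓞 F) F ω = _ from hωc]
      linear_combination (1 / 2 : F) * hx + (1 / 2 : F) * hcF
    have t1 : Algebra.trace ℚ F ω = 1 := by
      have : (ω : F) = algebraMap ℚ F (1 / 2) + (1 / 2 : ℚ) • θ := by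
        rw [hωc, Algebra.smul_def]; simp; ring
      rw [this, map_add, map_smul, htr, htc]; simp
    have t2 : Algebra.trace ℚ F ((ω : F) ^ 2) = (1 + m) / 2 := by
      have : (ω : F) ^ 2 = algebraMap ℚ F ((1 + m) / 4) + (1 / 2 : ℚ) • θ := by
        rw [hωc, Algebra.smul_def]; simp; linear_combination (1 / 4 : F) * hθ
      rw [this, map_add, map_smul, htr, htc]; simp; ring
    rw [t1, t2] at hd
    have : (NumberField.discr F : ℚ) = m := by rw [hd]; ring
    exact_mod_cast this
  · let ω : 𝓞 F := ⟨θ, hθint⟩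
    have hωc : (ω : F) = θ := rfl
    have hd := discr_eq_of_forall_exists_int_add_mul ω fun x => by
      obtain ⟨A, B, n, hx, hn⟩ := exists_two_mul_eq_add_mul hm hθ hθ' x
      have hm40 : ¬ m % 4 = 0 := fun h0 => by
        have := hm 2 (by omega)
        exact absurd (Int.isUnit_iff.1 this) (by norm_num)
      have hAB : Even A ∧ Even B := by
        rcases Int.even_or_odd' A with ⟨a, rfl | rfl⟩ <;> rcases Int.even_or_odd' B with ⟨b, rfl | rfl⟩
        · exact ⟨even_two_mul a, even_two_mul b⟩
        · exfalso
          have : m = 4 * (a ^ 2 - m * b ^ 2 - m * b - n) := by linear_combination -hn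
          omega
        · exfalso
          have : 1 = 4 * (n - a ^ 2 - a + m * b ^ 2) := by linear_combination hn
          omega
        · exfalso
          have : m = 4 * (a ^ 2 + a - m * b ^ 2 - m * b - n) + 1 := by linear_combination -hn
          omega
      obtain ⟨⟨a, ha⟩, ⟨b, hb⟩⟩ := hAB
      refine ⟨a, b, NumberField.RingOfIntegers.ext ?_⟩
      have ha' : (A : F) = a + a := by rw [ha]; push_cast; ring
      have hb' : (B : F) = b + b := by rw [hb]; push_cast; ring
      simp only [map_add, map_mul, map_intCast]
      rw [show algebraMap (𝓞 F) F ω = _ from hωc]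
      linear_combination (1 / 2 : F) * hx + (1 / 2 : F) * ha' + (1 / 2 : F) * θ * hb'
    have t2 : Algebra.trace ℚ F ((ω : F) ^ 2) = 2 * m := by
      rw [hωc, hθ, ← htc, map_intCast (algebraMap ℚ F)]
    rw [t2, hωc, htr] at hd
    have : (NumberField.discr F : ℚ) = 4 * m := by rw [hd]; ring
    exact_mod_cast this

end QuadraticDiscr

lemma irreducible_X_sq_sub_intCast {m : ℤ} (hm : Squarefree m) (hm1 : m ≠ 1) :
    Irreducible (Polynomial.X ^ 2 - Polynomial.C (m : ℚ)) := by
  refine X_pow_sub_C_irreducible_of_prime Nat.prime_two fun q hq => ?_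
  exact not_sq_rat_eq_squarefree hm hm1 q hq

/-- The field is built from `ℚ[X]` and not inside `M`, because the definition asks for a field in
`Type`. -/
lemma isQuadraticFieldDiscriminant_quadraticDiscr {m : ℤ} (hm : Squarefree m) (hm1 : m ≠ 1) :
    IsQuadraticFieldDiscriminant (quadraticDiscr m) := by
  have hirr := irreducible_X_sq_sub_intCast hm hm1
  have : Fact (Irreducible (Polynomial.X ^ 2 - Polynomial.C (m : ℚ))) := ⟨hirr⟩
  let F := AdjoinRoot (Polynomial.X ^ 2 - Polynomial.C (m : ℚ))
  have hfin : Module.finrank ℚ F = 2 := by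
    rw [(AdjoinRoot.powerBasis hirr.ne_zero).finrank, AdjoinRoot.powerBasis_dim,
      Polynomial.natDegree_X_pow_sub_C]
  have hF : NumberField F :=
    { to_charZero := charZero_of_injective_algebraMap (algebraMap ℚ F).injective
      to_finiteDimensional := Module.finite_of_finrank_pos (by rw [hfin]; norm_num) }
  have hquad : Algebra.IsQuadraticExtension ℚ F := ⟨hfin⟩
  have hroot : (AdjoinRoot.root (Polynomial.X ^ 2 - Polynomial.C (m : ℚ)) : F) ^ 2 = (m : F) := by
    have := AdjoinRoot.eval₂_root (Polynomial.X ^ 2 - Polynomial.C (m : ℚ))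
    simp only [Polynomial.eval₂_sub, Polynomial.eval₂_pow, Polynomial.eval₂_X,
        Polynomial.eval₂_C, sub_eq_zero] at this
    rw [this, map_intCast]
  refine ⟨F, inferInstance, hF, hquad, discr_eq_quadraticDiscr hm hroot fun q hq => ?_⟩
  rw [hq, ← map_pow, ← map_intCast (algebraMap ℚ F)] at hroot
  exact not_sq_rat_eq_squarefree hm hm1 q ((algebraMap ℚ F).injective hroot)

/-! ### Square roots attached to quadratic characters -/

section QuadraticCharacter

variable {M : Type*} [Field M] [NumberField M]

/-- A Lagrange resolvent, nonzero for some `x` by Dedekind's independence of automorphisms. -/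
lemma exists_ne_zero_apply_eq_character_mul (χ : Gal(M/ℚ) →* ℤˣ) :
    ∃ θ : M, θ ≠ 0 ∧ ∀ σ : Gal(M/ℚ), σ θ = ((χ σ : ℤ) : M) * θ := by
  obtain ⟨x, hx⟩ : ∃ x : M, ∑ σ : Gal(M/ℚ), ((χ σ : ℤ) : M) * σ x ≠ 0 := by
    by_contra! hcon
    have hli : LinearIndependent M (fun σ : Gal(M/ℚ) => ((σ : M →* M) : M → M)) :=
      (linearIndependent_monoidHom M M).comp (fun σ : Gal(M/ℚ) => (σ : M →* M)) fun σ τ h =>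
        AlgEquiv.ext fun x => DFunLike.congr_fun h x
    have := Fintype.linearIndependent_iff.1 hli (fun σ => ((χ σ : ℤ) : M))
      (by ext x; simpa [Finset.sum_apply] using hcon x) 1
    simp at this
  refine ⟨_, hx, fun τ => ?_⟩
  rw [map_sum, Finset.mul_sum]
  conv_rhs => rw [← Equiv.sum_comp (Equiv.mulLeft τ)]
  refine Finset.sum_congr rfl fun σ _ => ?_
  simp only [Equiv.coe_mulLeft, map_mul, map_intCast, AlgEquiv.mul_apply, Units.val_mul]
  push_cast
  have : ((χ τ : ℤ) : M) * ((χ τ : ℤ) : M) = 1 := by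
    rw [← Int.cast_mul, ← Units.val_mul, Int.units_mul_self]; simp
  rw [← mul_assoc, ← mul_assoc, this, one_mul]

lemma exists_squarefree_mul_sq {z : ℤ} (hz : z ≠ 0) :
    ∃ m s : ℤ, Squarefree m ∧ s ≠ 0 ∧ z = m * s ^ 2 := by
  obtain ⟨a, b, hab, ha⟩ := Nat.sq_mul_squarefree z.natAbs
  have hb : b ≠ 0 := by
    rintro rfl
    exact hz (by simpa using hab.symm)
  refine ⟨z.sign * a, b, ?_, by exact_mod_cast hb, ?_⟩
  · rw [← Int.squarefree_natAbs, Int.natAbs_mul, Int.natAbs_sign_of_ne_zero hz, one_mul]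
    simpa using ha
  · conv_lhs => rw [← Int.sign_mul_natAbs z, ← hab]
    push_cast; ring

variable [IsGalois ℚ M]

/-- A nontrivial quadratic character of `Gal(M/ℚ)` cuts out a field `ℚ(√m)`. -/
lemma exists_sqrt_of_character (χ : Gal(M/ℚ) →* ℤˣ) (hχ : χ ≠ 1) :
    ∃ (m : ℤ) (θ : M), Squarefree m ∧ m ≠ 1 ∧ θ ^ 2 = m ∧
      ∀ σ : Gal(M/ℚ), σ θ = ((χ σ : ℤ) : M) * θ := by
  obtain ⟨θ, hθ0, hθ⟩ := exists_ne_zero_apply_eq_character_mul χ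
  have hsq : ∀ σ : Gal(M/ℚ), σ (θ ^ 2) = θ ^ 2 := fun σ => by
    rw [map_pow, hθ, mul_pow, ← Int.cast_pow, ← Units.val_pow_eq_pow_val, sq (χ σ),
      Int.units_mul_self]
    simp
  obtain ⟨q, hq⟩ := IntermediateField.mem_bot.1 ((IsGalois.mem_bot_iff_fixed _).2 hsq)
  have hq0 : q ≠ 0 := by
    rintro rfl
    rw [map_zero] at hq
    exact hθ0 (pow_eq_zero_iff two_ne_zero |>.1 hq.symm)
  -- The integer `q.num * q.den` equals `q * q.den ^ 2`, so it has the square class of `q`.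
  obtain ⟨m, s, hm, hs, hz⟩ := exists_squarefree_mul_sq (z := q.num * q.den)
    (mul_ne_zero (Rat.num_ne_zero.2 hq0) (by exact_mod_cast q.den_ne_zero))
  have hsM : (s : M) ≠ 0 := by exact_mod_cast hs
  have hden : (q.den : ℚ) ≠ 0 := by exact_mod_cast q.den_ne_zero
  have hzq : q * q.den ^ 2 = m * s ^ 2 := by
    have h1 : ((q.num * q.den : ℤ) : ℚ) = ((m * s ^ 2 : ℤ) : ℚ) := by rw [hz]
    push_cast at h1
    rw [← h1, sq, ← mul_assoc, Rat.mul_den_eq_num]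
  have hzM : θ ^ 2 * (q.den : M) ^ 2 = m * (s : M) ^ 2 := by
    have := congrArg (algebraMap ℚ M) hzq
    simpa only [map_mul, map_pow, map_natCast, map_intCast, hq] using this
  have hdenM : (q.den : M) ≠ 0 := by exact_mod_cast q.den_ne_zero
  have hθ' : ∀ σ : Gal(M/ℚ), σ (θ * q.den / s) = ((χ σ : ℤ) : M) * (θ * q.den / s) := fun σ => by
    rw [map_div₀, map_mul, hθ, map_natCast, map_intCast]; ring
  have hsq' : (θ * q.den / s) ^ 2 = (m : M) := by
    rw [div_pow, mul_pow, hzM]; field_simp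
  refine ⟨m, θ * q.den / s, hm, ?_, hsq', hθ'⟩
  rintro rfl
  refine hχ (MonoidHom.ext fun σ => ?_)
  have hfix : σ (θ * q.den / s) = θ * q.den / s := by
    rcases sq_eq_sq_iff_eq_or_eq_neg.1 ((hsq'.trans Int.cast_one).trans (one_pow 2).symm) with h | h <;> simp [h]
  rw [hθ'] at hfix
  have h0 : θ * q.den / s ≠ 0 := div_ne_zero (mul_ne_zero hθ0 hdenM) hsM
  have := mul_right_cancel₀ h0 (hfix.trans (one_mul _).symm)
  rw [MonoidHom.one_apply, ← Units.val_inj, Units.val_one]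
  exact_mod_cast this

/-- Otherwise inertia at `P` would fix `ℚ(θ)`, although `p` divides the discriminant of that field.
-/
lemma exists_mem_inertia_apply_ne_of_dvd_quadraticDiscr {m : ℤ} (hm : Squarefree m) (hm1 : m ≠ 1)
    {θ : M} (hθ : θ ^ 2 = m) {p : ℕ} (hp : p.Prime) (hpm : (p : ℤ) ∣ quadraticDiscr m)
    (P : Ideal (𝓞 M)) [P.IsPrime] (hP : (p : 𝓞 M) ∈ P) :
    ∃ g ∈ P.inertia Gal(M/ℚ), g θ ≠ θ := by
  open IntermediateField in
  by_contra! hcon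
  have hmin : minpoly ℚ θ = Polynomial.X ^ 2 - Polynomial.C (m : ℚ) :=
    (minpoly.eq_of_irreducible_of_monic (irreducible_X_sq_sub_intCast hm hm1) (by simp [hθ])
      (Polynomial.monic_X_pow_sub_C _ two_ne_zero)).symm
  have hquad : Algebra.IsQuadraticExtension ℚ ℚ⟮θ⟯ := ⟨by
    rw [IntermediateField.adjoin.finrank (Algebra.IsIntegral.isIntegral θ), hmin,
      Polynomial.natDegree_X_pow_sub_C]⟩
  have hgen : (AdjoinSimple.gen ℚ θ) ^ 2 = (m : ℚ⟮θ⟯) := Subtype.ext (by simpa using hθ)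
  have hdiscr := discr_eq_quadraticDiscr (F := ℚ⟮θ⟯) hm hgen fun q hq => by
    rw [hq, ← map_pow, ← map_intCast (algebraMap ℚ ℚ⟮θ⟯)] at hgen
    exact not_sq_rat_eq_squarefree hm hm1 q ((algebraMap ℚ ℚ⟮θ⟯).injective hgen)
  refine not_inertia_le_fixingSubgroup_of_dvd_discr ℚ⟮θ⟯ hp (by rwa [hdiscr]) P hP ?_
  rw [← IntermediateField.le_iff_le, IntermediateField.adjoin_simple_le_iff]
  rintro ⟨g, hg⟩
  exact hcon g hg

/-- Normality of `M` lets complex conjugation descend through an embedding into `ℂ`, where square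
roots of negative numbers are purely imaginary. -/
lemma exists_complexConj_neg : ∃ σ : Gal(M/ℚ), σ ^ 2 = 1 ∧
    ∀ (m : ℤ) (θ : M), m < 0 → θ ^ 2 = m → σ θ = -θ := by
  obtain ⟨φ⟩ : Nonempty (M →+* ℂ) := inferInstance
  obtain ⟨τ, hτ⟩ := NumberField.ComplexEmbedding.exists_comp_symm_eq_of_comp_eq (k := ℚ) φ
    (NumberField.ComplexEmbedding.conjugate φ) (Subsingleton.elim _ _)
  have hτ' : ∀ x, φ (τ.symm x) = starRingEnd ℂ (φ x) := fun x => DFunLike.congr_fun hτ x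
  refine ⟨τ.symm, AlgEquiv.ext fun x => φ.injective ?_, fun m θ hm hθ => φ.injective ?_⟩
  · rw [sq, AlgEquiv.mul_apply, hτ', hτ']; simp
  · rw [hτ', map_neg]
    have h1 : φ θ ^ 2 = ((m : ℝ) : ℂ) := by rw [← map_pow, hθ]; simp
    have hm' : (m : ℝ) < 0 := by exact_mod_cast hm
    have hre := congrArg Complex.re h1
    have him := congrArg Complex.im h1
    simp only [sq, Complex.mul_re, Complex.mul_im, Complex.ofReal_re, Complex.ofReal_im] at hre him
    have h0 : (φ θ).re = 0 := by
      by_contra hne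
      have : (φ θ).im = 0 := by
        have : (φ θ).re * (φ θ).im = 0 := by linarith
        exact (mul_eq_zero.1 this).resolve_left hne
      rw [this] at hre
      nlinarith [sq_nonneg (φ θ).re]
    apply Complex.ext <;> simp [h0]

end QuadraticCharacter

/-! ### Discriminant arithmetic and the Kronecker symbol -/

section QuadraticDiscrArithmetic

lemma dvd_quadraticDiscr (m : ℤ) : m ∣ quadraticDiscr m := by
  rw [quadraticDiscr]; split_ifs <;> simp

lemma quadraticDiscr_neg_iff (m : ℤ) : quadraticDiscr m < 0 ↔ m < 0 := by
  rw [quadraticDiscr]; split_ifs <;> omega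

lemma emod_four_eq_one_of_not_two_dvd {m : ℤ} (h : ¬ (2 : ℤ) ∣ quadraticDiscr m) : m % 4 = 1 := by
  rw [quadraticDiscr] at h
  split_ifs at h <;> omega

lemma quadraticDiscr_mul {m n : ℤ} (h : m % 4 = 1 ∨ n % 4 = 1) :
    quadraticDiscr (m * n) = quadraticDiscr m * quadraticDiscr n := by
  rcases h with h | h
  · have : m * n % 4 = n % 4 := by rw [Int.mul_emod, h, one_mul, Int.emod_emod_of_dvd _ dvd_rfl]
    simp only [quadraticDiscr, this, h, if_true]
    split_ifs <;> ring
  · have : m * n % 4 = m % 4 := by rw [Int.mul_emod, h, mul_one, Int.emod_emod_of_dvd _ dvd_rfl]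
    simp only [quadraticDiscr, this, h, if_true]
    split_ifs <;> ring

-- For odd `p`, `β` is congruent to an integer modulo `P`, so `n` is a square modulo `p`. For `p =
-- 2` the same argument is applied to `(1 + β) / 2`, a root of `X² - X - s` with `n = 4s + 1`: then
-- `s ≡ a² - a` is even and `n ≡ 1` modulo `8`.
open scoped Pointwise in
lemma kroneckerAtPrime_quadraticDiscr_eq_one {M : Type*} [Field M] [NumberField M] [IsGalois ℚ M]
    {p : ℕ} [hp : Fact p.Prime] (P : Ideal (𝓞 M)) [P.IsPrime] (hP : (p : 𝓞 M) ∈ P)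
    {n : ℤ} {β : M} (hβ : β ^ 2 = n) (hn : ¬ (p : ℤ) ∣ quadraticDiscr n)
    (hfix : ∀ g ∈ MulAction.stabilizer Gal(M/ℚ) P, g β = β) :
    kroneckerAtPrime (quadraticDiscr n) p = 1 := by
  have hp' : Prime (p : ℤ) := Nat.prime_iff_prime_int.1 hp.out
  have hover : P.LiesOver (.span {(p : ℤ)}) :=
    (Ideal.liesOver_span_iff Ideal.IsPrime.ne_top' hp').2 (by simpa using hP)
  have hdvd : ∀ z : ℤ, (z : 𝓞 M) ∈ P → (p : ℤ) ∣ z := fun z hz => by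
    rw [← Ideal.mem_span_singleton, Ideal.mem_of_liesOver P]
    simpa using hz
  rw [kroneckerAtPrime]
  split_ifs with h2
  · subst h2
    have hn4 := emod_four_eq_one_of_not_two_dvd hn
    rw [quadraticDiscr, if_pos hn4]
    obtain ⟨s, hs⟩ : ∃ s : ℤ, n = 4 * s + 1 := ⟨n / 4, by omega⟩
    have heq : ((1 + β) / 2) ^ 2 - (1 + β) / 2 = s := by
      have : (n : M) = 4 * s + 1 := by rw [hs]; push_cast; ring
      linear_combination (1 / 4 : M) * hβ + (1 / 4 : M) * this
    have hω : IsIntegral ℤ ((1 + β) / 2) := by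
      refine ⟨Polynomial.X ^ 2 - Polynomial.X - Polynomial.C s, by monicity!, ?_⟩
      simp only [Polynomial.eval₂_sub, Polynomial.eval₂_pow, Polynomial.eval₂_X,
        Polynomial.eval₂_C]
      rw [algebraMap_int_eq, eq_intCast, heq, sub_self]
    let ω : 𝓞 M := ⟨(1 + β) / 2, hω⟩
    obtain ⟨a, ha⟩ := exists_int_sub_mem_of_stabilizer_fixed hp.out P hP ω fun g hg =>
      NumberField.RingOfIntegers.ext (by
        change g ((1 + β) / 2) = (1 + β) / 2
        rw [map_div₀, map_add, hfix g hg, map_one, show g (2 : M) = 2 from map_ofNat g 2])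
    have hω2 : ω ^ 2 - ω = s := NumberField.RingOfIntegers.ext (by
      simp only [map_sub, map_pow, map_intCast]; exact heq)
    obtain ⟨c, hc⟩ := hdvd (s - (a ^ 2 - a)) (by
      have : ((s - (a ^ 2 - a) : ℤ) : 𝓞 M) = (ω + a - 1) * (ω - a) := by
        push_cast; rw [← hω2]; ring
      rw [this]; exact P.mul_mem_left _ ha)
    have h8 : n = 8 * (c + (a ^ 2 - a) / 2) + 1 := by
      obtain ⟨b, hb⟩ : (2 : ℤ) ∣ a ^ 2 - a := by
        have := (Int.even_mul_pred_self a).two_dvd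
        rwa [show a ^ 2 - a = a * (a - 1) by ring]
      push_cast at hc
      omega
    rw [h8]
    push_cast
    rw [show (8 : ZMod 8) = 0 from rfl, zero_mul, zero_add]
    decide
  · have hβint : IsIntegral ℤ β := by
      refine IsIntegral.of_pow (n := 2) two_pos ?_
      rw [hβ]; exact isIntegral_algebraMap (R := ℤ) (A := M)
    let ω : 𝓞 M := ⟨β, hβint⟩
    obtain ⟨a, ha⟩ := exists_int_sub_mem_of_stabilizer_fixed hp.out P hP ω fun g hg =>
      NumberField.RingOfIntegers.ext (hfix g hg)
    have hω2 : ω ^ 2 = n := NumberField.RingOfIntegers.ext (by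
      simp only [map_pow, map_intCast]; exact hβ)
    have hd := hdvd (n - a ^ 2) (by
      have : ((n - a ^ 2 : ℤ) : 𝓞 M) = (ω + a) * (ω - a) := by
        push_cast; rw [← hω2]; ring
      rw [this]; exact P.mul_mem_left _ ha)
    have hna : (n : ZMod p) = (a : ZMod p) ^ 2 := by
      have := (ZMod.intCast_zmod_eq_zero_iff_dvd _ p).2 hd
      push_cast at this
      exact sub_eq_zero.1 this
    rw [legendreSym.eq_one_iff p (fun h => hn ((ZMod.intCast_zmod_eq_zero_iff_dvd _ p).1 h)),
      quadraticDiscr]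
    split_ifs
    · exact ⟨a, by rw [hna, sq]⟩
    · exact ⟨2 * a, by push_cast; rw [hna]; ring⟩

end QuadraticDiscrArithmetic

/-! ### Inertia over `ℚ` when `M/k` is unramified -/

section UnramifiedOverQuadratic

open scoped Pointwise

variable {k : Type*} [Field k] [NumberField k]
  {M : Type*} [Field M] [NumberField M] [Algebra k M] [IsGalois ℚ M]

variable (k M) in
/-- The subgroup of `Gal(M/ℚ)` fixing `k`. -/
def relativeGalois : Subgroup Gal(M/ℚ) :=
  (AlgEquiv.restrictScalarsHom ℚ : Gal(M/k) →* Gal(M/ℚ)).range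

variable (k M) in
/-- `Gal(M/k)` as a subgroup of `Gal(M/ℚ)`. -/
noncomputable def relativeGaloisEquiv : Gal(M/k) ≃* relativeGalois k M :=
  MonoidHom.ofInjective (AlgEquiv.restrictScalarsHom_injective ℚ)

lemma eq_one_of_mem_inertia_of_mem_relativeGalois (hunr : IsUnramifiedOutsideInfinity k M)
    (P : Ideal (𝓞 M)) [P.IsPrime] (hP : P ≠ ⊥) {g : Gal(M/ℚ)} (hg : g ∈ P.inertia Gal(M/ℚ))
    (hgN : g ∈ relativeGalois k M) : g = 1 := by
  have : IsGalois k M := IsGalois.tower_top_of_isGalois ℚ k M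
  have := hunr P hP
  obtain ⟨g, rfl⟩ := hgN
  have hg' : g ∈ P.inertia Gal(M/k) := fun x => hg x
  rw [inertia_eq_bot_of_isUnramifiedAt, Subgroup.mem_bot] at hg'
  rw [hg', map_one]

lemma sq_eq_one_of_mem_inertia (hunr : IsUnramifiedOutsideInfinity k M)
    (hN : (relativeGalois k M).index = 2)
    (P : Ideal (𝓞 M)) [P.IsPrime] (hP : P ≠ ⊥) {g : Gal(M/ℚ)} (hg : g ∈ P.inertia Gal(M/ℚ)) :
    g ^ 2 = 1 :=
  eq_one_of_mem_inertia_of_mem_relativeGalois hunr P hP (pow_mem hg 2)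
    (Subgroup.sq_mem_of_index_two hN g)

lemma closure_involutions_eq_top (hunr : IsUnramifiedOutsideInfinity k M)
    (hN : (relativeGalois k M).index = 2) :
    Subgroup.closure {g : Gal(M/ℚ) | g ^ 2 = 1 ∧ g ∉ relativeGalois k M} = ⊤ := by
  refine eq_top_of_forall_inertia_le _ fun P _ hP g hg => ?_
  by_cases hgN : g ∈ relativeGalois k M
  · rw [eq_one_of_mem_inertia_of_mem_relativeGalois hunr P hP hg hgN]
    exact one_mem _
  · exact Subgroup.subset_closure ⟨sq_eq_one_of_mem_inertia hunr hN P hP hg, hgN⟩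

/-- The decomposition group normalizes inertia, which has at most one nontrivial element. -/
lemma mul_comm_of_mem_inertia_of_mem_stabilizer (hunr : IsUnramifiedOutsideInfinity k M)
    (hN : (relativeGalois k M).index = 2)
    (P : Ideal (𝓞 M)) [P.IsPrime] (hP : P ≠ ⊥) {g h : Gal(M/ℚ)} (hg : g ∈ P.inertia Gal(M/ℚ))
    (hh : h ∈ MulAction.stabilizer Gal(M/ℚ) P) : g * h = h * g := by
  have hconj : h * g * h⁻¹ ∈ P.inertia Gal(M/ℚ) := by
    intro x
    have h1 : g • (h⁻¹ • x) - h⁻¹ • x ∈ P := hg _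
    have h2 : h • (g • (h⁻¹ • x) - h⁻¹ • x) ∈ h • P := Ideal.smul_mem_pointwise_smul _ _ _ h1
    rw [MulAction.mem_stabilizer_iff.1 hh, smul_sub, smul_inv_smul, ← mul_smul, ← mul_smul] at h2
    simpa [mul_assoc] using h2
  have hmem : h * g * h⁻¹ * g ∈ relativeGalois k M := by
    simp only [Subgroup.mul_mem_iff_of_index_two hN, inv_mem_iff]
    tauto
  have h1 := eq_one_of_mem_inertia_of_mem_relativeGalois hunr P hP (mul_mem hconj hg) hmem
  have hgg : g * g = 1 := by rw [← sq, sq_eq_one_of_mem_inertia hunr hN P hP hg]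
  have h2 : h * g * h⁻¹ = g := by
    rw [eq_inv_of_mul_eq_one_left h1]; exact inv_eq_of_mul_eq_one_right hgg
  calc g * h = h * g * h⁻¹ * h := by rw [h2]
    _ = h * g := by group

end UnramifiedOverQuadratic

/-! ### The main theorem -/

theorem mainTheorem3
    (k : Type*) [Field k] [NumberField k] [Algebra.IsQuadraticExtension ℚ k]
    (M : Type*) [Field M] [NumberField M] [Algebra k M]
    (hunr : IsUnramifiedOutsideInfinity k M)
    (hH8 : Nonempty (Gal(M/k) ≃* QuaternionGroup 2))
    (hnormal : IsGalois ℚ M) :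
    Nonempty (Gal(M/ℚ) ≃* CentralProductD4C4) ∧
    ∃ d₁ d₂ d₃ : ℤ,
      IsQuadraticFieldDiscriminant d₁ ∧ IsQuadraticFieldDiscriminant d₂ ∧
      IsQuadraticFieldDiscriminant d₃ ∧
      NumberField.discr k = d₁ * d₂ * d₃ ∧
      (¬ (d₁ < 0 ∧ d₂ < 0) ∧ ¬ (d₁ < 0 ∧ d₃ < 0) ∧ ¬ (d₂ < 0 ∧ d₃ < 0)) ∧
      ∀ (p : ℕ) [Fact p.Prime],
        ((p : ℤ) ∣ d₃ → kroneckerAtPrime (d₁ * d₂) p = 1) ∧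
        ((p : ℤ) ∣ d₁ → kroneckerAtPrime (d₂ * d₃) p = 1) ∧
        ((p : ℤ) ∣ d₂ → kroneckerAtPrime (d₃ * d₁) p = 1) := by
  obtain ⟨eH⟩ := hH8
  have hgal : IsGalois k M := IsGalois.tower_top_of_isGalois ℚ k M
  have hcardk : Nat.card Gal(M/k) = 8 := by
    rw [Nat.card_congr eH.toEquiv, Nat.card_eq_fintype_card, QuaternionGroup.card]
  have hcard : Nat.card Gal(M/ℚ) = 16 := by
    rw [IsGalois.card_aut_eq_finrank, ← Module.finrank_mul_finrank ℚ k M,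
      Algebra.IsQuadraticExtension.finrank_eq_two ℚ k, ← IsGalois.card_aut_eq_finrank k M, hcardk]
  have hcardN : Nat.card (relativeGalois k M) = 8 := by
    rw [← Nat.card_congr (relativeGaloisEquiv k M).toEquiv, hcardk]
  have hN : (relativeGalois k M).index = 2 := by
    have := (relativeGalois k M).card_mul_index
    rw [hcard, hcardN] at this
    omega
  obtain ⟨u, v, c, huvc⟩ := exists_isCentralQuaternionTriple (relativeGalois k M) hN
    ((relativeGaloisEquiv k M).symm.trans eH) (closure_involutions_eq_top hunr hN)
  obtain ⟨e, he⟩ := huvc.exists_mulEquiv hcard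
  refine ⟨⟨e⟩, ?_⟩
  let χ : Fin 3 → (Gal(M/ℚ) →* ℤˣ) := fun i => (CentralProductD4C4.character i).comp e.toMonoidHom
  have hχ : ∀ i, χ i ≠ 1 := fun i h => CentralProductD4C4.character_ne_one i <|
    MonoidHom.ext fun x => by
      obtain ⟨g, rfl⟩ := e.surjective x
      exact DFunLike.congr_fun h g
  have hχsq : ∀ g : Gal(M/ℚ), g ^ 2 = 1 → ∀ i j, i ≠ j → χ i g = 1 ∨ χ j g = 1 := fun g hg =>
    CentralProductD4C4.character_of_sq (e g) (by rw [← map_pow, hg, map_one])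
  have hχcomm : ∀ g h : Gal(M/ℚ), g ^ 2 = 1 → g * h = h * g → ∀ i, χ i g ≠ 1 →
      χ (i + 1) h = χ (i + 2) h := fun g h hg hgh =>
    CentralProductD4C4.character_of_commute (e g) (e h) (by rw [← map_pow, hg, map_one])
      (by rw [← map_mul, hgh, map_mul])
  choose m θ hm hm1 hθ hθχ using fun i => exists_sqrt_of_character (χ i) (hχ i)
  have hθ0 : ∀ i, θ i ≠ 0 := fun i h => (hm i).ne_zero (by
    have := hθ i
    rw [h, zero_pow two_ne_zero] at this
    exact_mod_cast this.symm)
  have hmove : ∀ i g, g (θ i) ≠ θ i → χ i g ≠ 1 := fun i g h h1 => h (by rw [hθχ, h1]; simp)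
  have hprime : ∀ p : ℕ, p.Prime → ∃ (P : Ideal (𝓞 M)) (_ : P.IsPrime), P ≠ ⊥ ∧ (p : 𝓞 M) ∈ P := by
    intro p hp
    have hp' : Prime (p : ℤ) := Nat.prime_iff_prime_int.1 hp
    have hmax : (Ideal.span {(p : ℤ)}).IsMaximal :=
      PrincipalIdealRing.isMaximal_of_irreducible hp'.irreducible
    obtain ⟨P, hP, hPp⟩ :=
      Ideal.exists_maximal_ideal_liesOver_of_isIntegral (S := 𝓞 M) (Ideal.span {(p : ℤ)})
    refine ⟨P, hP.isPrime, Ideal.IsMaximal.ne_bot_of_isIntegral_int P, ?_⟩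
    simpa using (Ideal.liesOver_span_iff hP.isPrime.ne_top hp').1 hPp
  have hinertia : ∀ p : ℕ, p.Prime → ∀ (P : Ideal (𝓞 M)) [P.IsPrime], (p : 𝓞 M) ∈ P →
      ∀ i, (p : ℤ) ∣ quadraticDiscr (m i) → ∃ g ∈ P.inertia Gal(M/ℚ), χ i g ≠ 1 := by
    intro p hp P _ hpP i hpi
    obtain ⟨g, hg, hgθ⟩ := exists_mem_inertia_apply_ne_of_dvd_quadraticDiscr (hm i) (hm1 i) (hθ i)
      hp hpi P hpP
    exact ⟨g, hg, hmove i g hgθ⟩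
  -- A common prime would give inertia elements `g`, `h` with `χ i g` and `χ j h` nontrivial. Both
  -- are the unique nontrivial inertia element, an involution, which contradicts `hχsq`.
  have hcop : ∀ p : ℕ, p.Prime → ∀ i j, i ≠ j → (p : ℤ) ∣ quadraticDiscr (m i) →
      ¬ (p : ℤ) ∣ quadraticDiscr (m j) := by
    intro p hp i j hij hpi hpj
    obtain ⟨P, _, hP0, hpP⟩ := hprime p hp
    obtain ⟨g, hg, hgi⟩ := hinertia p hp P hpP i hpi
    obtain ⟨h, hh, hhj⟩ := hinertia p hp P hpP j hpj
    have hg2 := sq_eq_one_of_mem_inertia hunr hN P hP0 hg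
    have hgN : g ∉ relativeGalois k M := fun hgN => hgi (by
      rw [eq_one_of_mem_inertia_of_mem_relativeGalois hunr P hP0 hg hgN, map_one])
    have hhN : h ∉ relativeGalois k M := fun hhN => hhj (by
      rw [eq_one_of_mem_inertia_of_mem_relativeGalois hunr P hP0 hh hhN, map_one])
    have hgh : g * h = 1 := eq_one_of_mem_inertia_of_mem_relativeGalois hunr P hP0 (mul_mem hg hh)
      (by rw [Subgroup.mul_mem_iff_of_index_two hN]; exact iff_of_false hgN hhN)
    have : h = g := by
      rw [← inv_eq_of_mul_eq_one_right hgh]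
      exact inv_eq_of_mul_eq_one_right (by rw [← sq, hg2])
    subst this
    exact (hχsq h hg2 i j hij).elim hgi hhj
  have hmod : ∀ i j, i ≠ j → m i % 4 = 1 ∨ m j % 4 = 1 := by
    intro i j hij
    by_cases h2 : (2 : ℤ) ∣ quadraticDiscr (m i)
    · exact Or.inr (emod_four_eq_one_of_not_two_dvd (hcop 2 Nat.prime_two i j hij h2))
    · exact Or.inl (emod_four_eq_one_of_not_two_dvd h2)
  have hrel : ∀ i j, i ≠ j → IsRelPrime (m i) (m j) := by
    intro i j hij
    rw [isRelPrime_iff_isCoprime, Int.isCoprime_iff_gcd_eq_one]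
    by_contra hne
    obtain ⟨p, hp, hpd⟩ := Nat.exists_prime_and_dvd hne
    have hpd' : (p : ℤ) ∣ Int.gcd (m i) (m j) := by exact_mod_cast hpd
    exact hcop p hp i j hij ((hpd'.trans (Int.gcd_dvd_left ..)).trans (dvd_quadraticDiscr _))
      ((hpd'.trans (Int.gcd_dvd_right ..)).trans (dvd_quadraticDiscr _))
  have hsqf : Squarefree (m 0 * m 1 * m 2) := by
    refine squarefree_mul_iff.2 ⟨(hrel 0 2 (by decide)).mul_left (hrel 1 2 (by decide)), ?_, hm 2⟩
    exact squarefree_mul_iff.2 ⟨hrel 0 1 (by decide), hm 0, hm 1⟩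
  have hact : ∀ g : Gal(M/ℚ), g (θ 0 * θ 1 * θ 2) =
      (((χ 0 g * χ 1 g * χ 2 g : ℤˣ) : ℤ) : M) * (θ 0 * θ 1 * θ 2) := by
    intro g
    rw [map_mul, map_mul, hθχ, hθχ, hθχ]
    push_cast; ring
  -- The product of the three roots is fixed by exactly the elements of `N`, so it lies in `k` but
  -- not in `ℚ`.
  have hdiscr : NumberField.discr k = quadraticDiscr (m 0 * m 1 * m 2) := by
    have hfix : ∀ g : Gal(M/k), g (θ 0 * θ 1 * θ 2) = θ 0 * θ 1 * θ 2 := by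
      intro g
      have hgN : AlgEquiv.restrictScalarsHom ℚ g ∈ relativeGalois k M := ⟨g, rfl⟩
      have h1 := hact (AlgEquiv.restrictScalarsHom ℚ g)
      have h2 : χ 0 (AlgEquiv.restrictScalarsHom ℚ g) * χ 1 (AlgEquiv.restrictScalarsHom ℚ g) *
        χ 2 (AlgEquiv.restrictScalarsHom ℚ g) = 1 := (he _).1 hgN
      rw [h2, Units.val_one, Int.cast_one, one_mul] at h1
      exact h1
    obtain ⟨y, hy⟩ := IntermediateField.mem_bot.1 ((IsGalois.mem_bot_iff_fixed _).2 hfix)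
    refine discr_eq_quadraticDiscr (θ := y) hsqf ((algebraMap k M).injective ?_) ?_
    · rw [map_pow, hy, map_intCast, mul_pow, mul_pow, hθ, hθ, hθ]
      push_cast; ring
    · rintro q rfl
      obtain ⟨g, hg⟩ : ∃ g, g ∉ relativeGalois k M := by
        by_contra! h
        rw [(Subgroup.eq_top_iff' _).2 h, Subgroup.index_top] at hN
        omega
      refine hg ((he g).2 ?_)
      have h1 := hact g
      rw [← hy, ← IsScalarTower.algebraMap_apply, AlgEquiv.commutes,
        IsScalarTower.algebraMap_apply ℚ k M, hy] at h1
      have h2 := mul_right_cancel₀ (mul_ne_zero (mul_ne_zero (hθ0 0) (hθ0 1)) (hθ0 2))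
        ((one_mul _).trans h1)
      rw [← Units.val_inj, Units.val_one]
      exact_mod_cast h2.symm
  have hkron : ∀ (p : ℕ) [Fact p.Prime] (i : Fin 3), (p : ℤ) ∣ quadraticDiscr (m i) →
      kroneckerAtPrime (quadraticDiscr (m (i + 1)) * quadraticDiscr (m (i + 2))) p = 1 := by
    intro p hp i hpi
    have hi1 : i ≠ i + 1 := (by decide : ∀ i : Fin 3, i ≠ i + 1) i
    have hi2 : i ≠ i + 2 := (by decide : ∀ i : Fin 3, i ≠ i + 2) i
    have hi12 : i + 1 ≠ i + 2 := (by decide : ∀ i : Fin 3, i + 1 ≠ i + 2) i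
    obtain ⟨P, _, hP0, hpP⟩ := hprime p hp.out
    obtain ⟨g, hg, hgi⟩ := hinertia p hp.out P hpP i hpi
    have hg2 := sq_eq_one_of_mem_inertia hunr hN P hP0 hg
    rw [← quadraticDiscr_mul (hmod _ _ hi12)]
    refine kroneckerAtPrime_quadraticDiscr_eq_one (M := M) P hpP (β := θ (i + 1) * θ (i + 2)) ?_ ?_ ?_
    · rw [mul_pow, hθ, hθ]; push_cast; ring
    · rw [quadraticDiscr_mul (hmod _ _ hi12)]
      intro h
      rcases (Nat.prime_iff_prime_int.1 hp.out).dvd_or_dvd h with h | h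
      · exact hcop p hp.out _ _ hi1 hpi h
      · exact hcop p hp.out _ _ hi2 hpi h
    -- On the decomposition group `χ (i + 1) = χ (i + 2)`, so the two signs cancel on the product of
    -- the roots.
    · intro h hh
      have hgh := mul_comm_of_mem_inertia_of_mem_stabilizer hunr hN P hP0 hg hh
      have h1 : ((χ (i + 2) h : ℤ) : M) * ((χ (i + 2) h : ℤ) : M) = 1 := by
        rw [← Int.cast_mul, ← Units.val_mul, Int.units_mul_self]; simp
      rw [map_mul, hθχ, hθχ, hχcomm g h hg2 hgh i hgi]
      linear_combination (θ (i + 1) * θ (i + 2)) * h1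
  obtain ⟨σ, hσ2, hσ⟩ := exists_complexConj_neg (M := M)
  have hsign : ∀ i j, i ≠ j → ¬ (quadraticDiscr (m i) < 0 ∧ quadraticDiscr (m j) < 0) := by
    rintro i j hij ⟨hi, hj⟩
    have hne : ∀ i, quadraticDiscr (m i) < 0 → χ i σ ≠ 1 := fun i hi => by
      refine hmove i σ ?_
      rw [hσ (m i) (θ i) ((quadraticDiscr_neg_iff _).1 hi) (hθ i)]
      exact fun h => hθ0 i (neg_eq_self.1 h)
    exact (hχsq σ hσ2 i j hij).elim (hne i hi) (hne j hj)
  refine ⟨quadraticDiscr (m 0), quadraticDiscr (m 1), quadraticDiscr (m 2),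
    isQuadraticFieldDiscriminant_quadraticDiscr (hm 0) (hm1 0),
    isQuadraticFieldDiscriminant_quadraticDiscr (hm 1) (hm1 1),
    isQuadraticFieldDiscriminant_quadraticDiscr (hm 2) (hm1 2), ?_,
    ⟨hsign 0 1 (by decide), hsign 0 2 (by decide), hsign 1 2 (by decide)⟩,
    fun p _ => ⟨hkron p 2, hkron p 0, hkron p 1⟩⟩
  rw [hdiscr, quadraticDiscr_mul, quadraticDiscr_mul (hmod 0 1 (by decide))]
  -- At most one `m i` fails to be `1` modulo `4`, so either `m 2` or `m 0 * m 1` is.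
  rcases hmod 0 2 (by decide) with h0 | h2
  · rcases hmod 1 2 (by decide) with h1 | h2
    · left; rw [Int.mul_emod, h0, h1]; rfl
    · exact Or.inr h2
  · exact Or.inr h2
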